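/- Let $\mathbf{o}_{\mathrm{Tx}},\mathbf{o}_{\mathrm{Rx}}$ be independent random vectors, each uniformly distributed on the unit sphere of $\mathbb{R}^3$, and let $\mathbf{u}\in\mathbb{R}^3$ be a fixed unit vector. Define the near- and far-field alignment factors $$J_{\mathrm{NF}}=\tfrac12\,\mathbf{o}_{\mathrm{Rx}}^{T}(3\mathbf{u}\mathbf{u}^{T}-I)\mathbf{o}_{\mathrm{Tx}},\qquad J_{\mathrm{FF}}=\mathbf{o}_{\mathrm{Rx}}^{T}(I-\mathbf{u}\mathbf{u}^{T})\mathbf{o}_{\mathrm{Tx}},$$ and, for $\alpha\in\mathbb{C}\setminus\{0\}$ and $kr>0$, the channel coefficient $$h=\alpha\Big(\Big(\tfrac{1}{(kr)^3}+\tfrac{j}{(kr)^2}\Big)J_{\mathrm{NF}}+\tfrac{1}{2kr}J_{\mathrm{FF}}\Big),\qquad |h_{\mathrm{opt}}|^2=\max_{\|\mathbf{o}_{\mathrm{Tx}}\|=\|\mathbf{o}_{\mathrm{Rx}}\|=1}|h|^2 .$$ Write $F_X(s)=\Pr[X\le s]$. Let either $J_*=J_{\mathrm{NF}}$ (near-field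 region, with regime $kr\to0^+$) or $J_*=J_{\mathrm{FF}}$ (far-field region, with regime $kr\to\infty$). Then the following hold. (i) $J_*$ has a continuous probability density $f_{J_*}$, namely $$f_{J_{\mathrm{NF}}}(x)=\frac{\operatorname{arcosh}2}{\sqrt3}\cdot\begin{cases}1,&|x|\le\frac12,\\ 1-\frac{\operatorname{arcosh}(2|x|)}{\operatorname{arcosh}2},&\frac12<|x|<1,\\ 0,&|x|\ge1,\end{cases}\qquad f_{J_{\mathrm{FF}}}(x)=\tfrac12\big(\tfrac\pi2-\arcsin|x|\big)\mathbf 1_{[-1,1]}(x).$$ (ii) For all $\alpha\ne0$ and $kr>0$, when $|h|^2$ is replaced by $|h_{\mathrm{opt}}|^2J_*^2$, $$F_{|h_{\mathrm{opt}}|^2J_*^2}(s)\le\frac{2f_{J_*}(0)}{|h_{\mathrm{opt}}|}\sqrt s\quad\text{for all } s\ge0,$$ and the ratio of the left-hand side to the right-hand side tends to $1$ as $s\to0^+$. (iii) In the regime of the region, this replacement is asymptotically exact: for every $\varepsilon>0$, for all $kr$ sufficiently small (near field) respectively sufficiently large (far field), $|F_{|h|^2}(s)-F_{|h_{\mathrm{opt}}|^2J_*^2}(s)|\le\varepsilon$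 for all $\alpha\neq0$ and all $s\in\mathbb{R}$. (iv) Consequently $F_{|h|^2}(s)\approx\frac{2f_{J_*}(0)}{|h_{\mathrm{opt}}|}\sqrt s$ in the region, accurately for $s\ll|h_{\mathrm{opt}}|^2$: for every $\varepsilon>0$ there is $\tau>0$ such that for every $t\in(0,\tau)$, for all $kr$ sufficiently small respectively sufficiently large, all $\alpha\ne0$, and all $s$ with $t|h_{\mathrm{opt}}|^2\le s\le\tau|h_{\mathrm{opt}}|^2$, $$\left|F_{|h|^2}(s)\Big/\Big(\frac{2f_{J_*}(0)}{|h_{\mathrm{opt}}|}\sqrt s\Big)-1\right|\le\varepsilon .$$ -/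

import Mathlib

open MeasureTheory ProbabilityTheory Filter Topology

namespace DipoleChannel

/-- Three-dimensional Euclidean space. -/
abbrev E3 := EuclideanSpace ℝ (Fin 3)

noncomputable section

/-- The uniform distribution on the unit sphere of `ℝ³` (normalized surface measure), as a measure
on the ambient space. -/
def uniformSphere : Measure E3 :=
  (((volume : Measure E3).toSphere Set.univ)⁻¹ • (volume : Measure E3).toSphere).map
    (Subtype.val : Metric.sphere (0 : E3) 1 → E3)

/-- The scaled near field `(1/2) (3 d dᵀ - I) u` for the transmitter-to-receiver direction `d` and
the transmit orientation `u`. -/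
def bNF (d u : E3) : E3 := (1 / 2 : ℝ) • ((3 * inner ℝ d u) • d - u)

/-- The scaled far field `(I - d dᵀ) u`. -/
def bFF (d u : E3) : E3 := u - (inner ℝ d u : ℝ) • d

/-- The near-field alignment factor; `v` is the receive orientation. -/
def JNF (d u v : E3) : ℝ := inner ℝ v (bNF d u)

/-- The far-field alignment factor. -/
def JFF (d u v : E3) : ℝ := inner ℝ v (bFF d u)

/-- The channel coefficient between two dipoles, with prefactor `α` and electrical distance
`kr` (wavenumber times link distance). -/
def channel (α : ℂ) (kr : ℝ) (d u v : E3) : ℂ :=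
  α * ((1 / (kr : ℂ) ^ 3 + Complex.I / (kr : ℂ) ^ 2) * (JNF d u v : ℂ)
    + 1 / (2 * (kr : ℂ)) * (JFF d u v : ℂ))

/-- The maximum power transfer efficiency over all pairs of orientations. -/
def etaOpt (α : ℂ) (kr : ℝ) (d : E3) : ℝ :=
  sSup {η : ℝ | ∃ u v : E3, ‖u‖ = 1 ∧ ‖v‖ = 1 ∧ η = ‖channel α kr d u v‖ ^ 2}

/-- The magnitude `|h_opt|` of the channel coefficient under optimal orientations. -/
def hOptAbs (α : ℂ) (kr : ℝ) (d : E3) : ℝ := √(etaOpt α kr d)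

/-- The density of the near-field alignment factor; here
`1 / (2 * b) = arcosh 2 / √3` for `b = √3 / (2 * arcosh 2)`. -/
def pdfJNF (x : ℝ) : ℝ :=
  1 / (2 * (√3 / (2 * Real.arcosh 2))) *
    (if |x| ≤ 1 / 2 then 1
      else if |x| < 1 then 1 - Real.arcosh (2 * |x|) / Real.arcosh 2
      else 0)

/-- The density of the far-field alignment factor. -/
def pdfJFF (x : ℝ) : ℝ :=
  (1 / 2) * (Real.pi / 2 - Real.arcsin |x|) * Set.indicator (Set.Icc (-1 : ℝ) 1) 1 x

/-- The two marginal regions: near field and far field. -/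
inductive Region where
  | near
  | far

/-- The alignment factor `J_*` that describes a region. -/
def Region.J : Region → E3 → E3 → E3 → ℝ
  | .near => JNF
  | .far => JFF

/-- The density `f_{J_*}` of the alignment factor that describes a region. -/
def Region.pdf : Region → ℝ → ℝ
  | .near => pdfJNF
  | .far => pdfJFF

/-- The asymptotic regime of `kr`: `kr → 0+` (near field) or `kr → ∞` (far field). -/
def Region.regime : Region → Filter ℝ
  | .near => 𝓝[>] 0
  | .far => atTop

/-- The cumulative distribution function `s ↦ P(X ≤ s)` of a real random variable `X`. -/
def cdfOf {Ω : Type*} [MeasurableSpace Ω] (μ : Measure Ω) (X : Ω → ℝ) (s : ℝ) : ℝ :=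
  cdf (μ.map X) s

end

end DipoleChannel

/-! Fix the transmit orientation `u`. Then `J_*` is the inner product of the uniform unit vector `v`
with a field vector `b u`. By Archimedes' hat-box theorem it is uniform on `[-‖b u‖, ‖b u‖]`. The
norm `‖b u‖ = β c` depends only on `c = ⟪d, u⟫`, which is itself uniform on `[-1, 1]`. Averaging
over `c` gives the density `x ↦ (1/2) ∫ 1{|x| ≤ β c} / (2 β c) dc`, with `β c = √(3c² + 1) / 2`
(near) or `√(1 - c²)` (far); the integrals are an `arsinh` and an `arcsin` (`Region.map_J`). This
density is continuous and maximal at `0`, so `P(|J_*| ≤ x) ≤ 2 f(0) x`, sharp as `x → 0`.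

For the exact channel, `h = α (A p + C J_FF)` with `p = ⟪v, d⟫⟪d, u⟫` and `|p| + |J_FF| ≤ 1`, hence
`|h_opt| = |α| max(‖A‖, ‖C‖)` (`hOptAbs_eq`). In either regime `|h|` differs from `|h_opt| |J_*|` by
at most `δ |h_opt|`, uniformly in the orientations and in `α`. Since the density is bounded by
`f(0)`, the distribution functions then differ by at most `2 f(0) δ` (`abs_cdfOf_sq_sub_le`). For `s
≥ t |h_opt|²` the square-root term is at least `2 f(0) √t`, which turns this absolute error into a
relative one. -/

namespace DipoleChannel

/-! ### Archimedes' hat-box theorem for the uniform measure on the sphere -/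

/-- In the plane, the squared Euclidean norm pushes Lebesgue measure forward to `π` times Lebesgue
measure on the half-line. -/
theorem map_sq_add_sq_volume :
    (volume : Measure (Fin 2 → ℝ)).map (fun y => y 0 ^ 2 + y 1 ^ 2) =
      ENNReal.ofReal Real.pi • volume.restrict (Set.Ici (0 : ℝ)) := by
  have hm : Measurable (fun y : Fin 2 → ℝ => y 0 ^ 2 + y 1 ^ 2) := by fun_prop
  have hIic : ∀ b : ℝ, (volume : Measure (Fin 2 → ℝ)).map (fun y => y 0 ^ 2 + y 1 ^ 2) (Set.Iic b) =
      ENNReal.ofReal Real.pi * ENNReal.ofReal b := by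
    intro b
    rw [Measure.map_apply hm measurableSet_Iic,
      ← (PiLp.volume_preserving_ofLp (Fin 2)).measure_preimage
        (hm measurableSet_Iic).nullMeasurableSet]
    rcases lt_or_ge b 0 with hb | hb
    · rw [ENNReal.ofReal_of_nonpos hb.le, mul_zero]
      convert measure_empty (μ := (volume : Measure (EuclideanSpace ℝ (Fin 2))))
      ext y
      simp only [Set.mem_preimage, Set.mem_Iic, Set.mem_empty_iff_false, iff_false, not_le]
      exact hb.trans_le (by positivity)
    · have : (WithLp.ofLp ⁻¹' ((fun y : Fin 2 → ℝ => y 0 ^ 2 + y 1 ^ 2) ⁻¹' Set.Iic b) :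
          Set (EuclideanSpace ℝ (Fin 2))) = Metric.closedBall 0 (√b) := by
        ext y
        simp [EuclideanSpace.norm_eq, Fin.sum_univ_two, Real.sqrt_le_sqrt_iff hb]
      rw [this, EuclideanSpace.volume_closedBall_fin_two, ← ENNReal.ofReal_pow (Real.sqrt_nonneg b),
        Real.sq_sqrt hb, mul_comm]
  have hIic' : ∀ b : ℝ, (ENNReal.ofReal Real.pi • volume.restrict (Set.Ici (0 : ℝ))) (Set.Iic b) =
      ENNReal.ofReal Real.pi * ENNReal.ofReal b := by
    intro b
    rw [Measure.smul_apply, Measure.restrict_apply measurableSet_Iic, Set.inter_comm,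
      Set.Ici_inter_Iic, Real.volume_Icc, sub_zero, smul_eq_mul]
  have : IsLocallyFiniteMeasure
      (ENNReal.ofReal Real.pi • volume.restrict (Set.Ici (0 : ℝ))) :=
    inferInstanceAs (IsLocallyFiniteMeasure (Real.pi.toNNReal • volume.restrict (Set.Ici (0 : ℝ))))
  symm
  refine Measure.ext_of_Ioc _ _ fun a b hab => ?_
  rw [← Set.Iic_sdiff_Iic,
    measure_sdiff (Set.Iic_subset_Iic.2 hab.le) measurableSet_Iic.nullMeasurableSet,
    measure_sdiff (Set.Iic_subset_Iic.2 hab.le) measurableSet_Iic.nullMeasurableSet,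
    hIic, hIic, hIic', hIic']
  · rw [hIic]; finiteness
  · rw [hIic']; finiteness

/-- Integration over `ℝ³` in the coordinates (first coordinate, squared norm). -/
theorem lintegral_coord_normSq {F : ℝ × ℝ → ENNReal} (hF : Measurable F) :
    ∫⁻ x : E3, F (x 0, ‖x‖ ^ 2) =
      ENNReal.ofReal Real.pi * ∫⁻ z : ℝ, ∫⁻ p in Set.Ici (z ^ 2), F (z, p) := by
  have h1 : ∫⁻ x : E3, F (x 0, ‖x‖ ^ 2) =
      ∫⁻ x : Fin 3 → ℝ, F (x 0, x 0 ^ 2 + (x 1 ^ 2 + x 2 ^ 2)) := by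
    rw [← (PiLp.volume_preserving_ofLp (Fin 3)).lintegral_comp
      (f := fun x : Fin 3 → ℝ => F (x 0, x 0 ^ 2 + (x 1 ^ 2 + x 2 ^ 2))) (by fun_prop)]
    refine lintegral_congr fun x => ?_
    rw [EuclideanSpace.norm_sq_eq, Fin.sum_univ_three]
    simp [add_assoc]
  have h2 : ∫⁻ x : Fin 3 → ℝ, F (x 0, x 0 ^ 2 + (x 1 ^ 2 + x 2 ^ 2)) =
      ∫⁻ q : ℝ × (Fin 2 → ℝ), F (q.1, q.1 ^ 2 + (q.2 0 ^ 2 + q.2 1 ^ 2)) := by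
    rw [← (volume_preserving_piFinSuccAbove (fun _ : Fin 3 => ℝ) 0).lintegral_comp
      (f := fun q : ℝ × (Fin 2 → ℝ) => F (q.1, q.1 ^ 2 + (q.2 0 ^ 2 + q.2 1 ^ 2)))
      (by fun_prop)]
    rfl
  rw [h1, h2, Measure.volume_eq_prod, lintegral_prod _ (by fun_prop),
    ← lintegral_const_mul' _ _ (by finiteness)]
  refine lintegral_congr fun z => ?_
  -- The last two coordinates enter only through `r`, the sum of their squares; translating by `z ^
  -- 2` turns the range `r ≥ 0` into `p ≥ z ^ 2`.
  rw [← lintegral_map (μ := (volume : Measure (Fin 2 → ℝ))) (f := fun r => F (z, z ^ 2 + r))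
    (g := fun y => y 0 ^ 2 + y 1 ^ 2) (by fun_prop) (by fun_prop), map_sq_add_sq_volume,
    lintegral_smul_measure, smul_eq_mul, ← lintegral_indicator measurableSet_Ici,
    ← lintegral_indicator measurableSet_Ici,
    ← lintegral_add_left_eq_self (fun p => (Set.Ici (z ^ 2)).indicator (fun p => F (z, p)) p)
      (z ^ 2)]
  congr 1
  refine lintegral_congr fun r => ?_
  by_cases hr : 0 ≤ r
  · rw [Set.indicator_of_mem (by simpa using hr), Set.indicator_of_mem (by simpa using hr)]
  · rw [Set.indicator_of_notMem (by simpa using hr), Set.indicator_of_notMem (by simpa using hr)]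

/-- The part of the unit ball where the cosine of the polar angle lies in `A`. -/
theorem volume_cone {A : Set ℝ} (hA : MeasurableSet A) :
    volume {x : E3 | 0 < ‖x‖ ∧ ‖x‖ < 1 ∧ x 0 / ‖x‖ ∈ A} =
      (ENNReal.ofReal Real.pi * ∫⁻ p in Set.Ioo (0 : ℝ) 1, ENNReal.ofReal √p) *
        volume (A ∩ Set.Icc (-1) 1) := by
  classical
  set S : Set (ℝ × ℝ) := {q | 0 < q.2 ∧ q.2 < 1 ∧ q.1 / √q.2 ∈ A} with hS
  have hSm : MeasurableSet S := by
    have h3 : Measurable fun q : ℝ × ℝ => q.1 / √q.2 := by fun_prop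
    exact (measurableSet_lt measurable_const measurable_snd).inter
      ((measurableSet_lt measurable_snd measurable_const).inter (h3 hA))
  have hset : {x : E3 | 0 < ‖x‖ ∧ ‖x‖ < 1 ∧ x 0 / ‖x‖ ∈ A} =
      (fun x : E3 => (x 0, ‖x‖ ^ 2)) ⁻¹' S := by
    ext x
    have h0 : 0 < ‖x‖ ^ 2 ↔ 0 < ‖x‖ := by
      rw [sq_pos_iff, norm_ne_zero_iff, norm_pos_iff]
    have h1 : ‖x‖ ^ 2 < 1 ↔ ‖x‖ < 1 := by
      rw [sq_lt_one_iff₀ (norm_nonneg x)]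
    simp only [Set.mem_ofPred_eq, hS, Set.mem_preimage, Real.sqrt_sq (norm_nonneg x), h0, h1]
  have hm : Measurable fun x : E3 => (x 0, ‖x‖ ^ 2) := by fun_prop
  rw [hset, ← lintegral_indicator_one (hm hSm)]
  have h1 : ∀ x : E3, ((fun x : E3 => (x 0, ‖x‖ ^ 2)) ⁻¹' S).indicator (1 : E3 → ENNReal) x =
      S.indicator (1 : ℝ × ℝ → ENNReal) (x 0, ‖x‖ ^ 2) := fun x => rfl
  simp_rw [h1]
  rw [lintegral_coord_normSq (measurable_one.indicator hSm), mul_assoc]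
  congr 1
  simp_rw [← lintegral_indicator measurableSet_Ici]
  -- For a fixed squared norm `p`, the substitution `z = √p * c` has Jacobian `√p` and turns `z ^ 2
  -- ≤ p` into `c ∈ [-1, 1]`, so the double integral factors.
  rw [lintegral_lintegral_swap]
  · rw [← lintegral_mul_const _ (by fun_prop), ← lintegral_indicator measurableSet_Ioo]
    refine lintegral_congr fun p => ?_
    by_cases hp : p ∈ Set.Ioo (0 : ℝ) 1
    · rw [Set.indicator_of_mem hp]
      have hp0 : 0 < √p := Real.sqrt_pos.2 hp.1
      have hinv : (√p)⁻¹ ≠ 0 := by positivity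
      have h3 : volume ((fun z => (√p)⁻¹ * z) ⁻¹' (A ∩ Set.Icc (-1) 1)) =
          ENNReal.ofReal √p * volume (A ∩ Set.Icc (-1) 1) := by
        rw [Real.volume_preimage_mul_left hinv, inv_inv, abs_of_pos hp0]
      rw [← h3, ← lintegral_indicator_one (by measurability)]
      refine lintegral_congr fun z => ?_
      have h4 : z ^ 2 ≤ p ↔ -1 ≤ (√p)⁻¹ * z ∧ (√p)⁻¹ * z ≤ 1 := by
        rw [← abs_le, abs_mul, abs_of_pos (inv_pos.2 hp0), inv_mul_le_iff₀ hp0, mul_one,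
          ← Real.sqrt_sq_eq_abs, Real.sqrt_le_sqrt_iff hp.1.le]
      have h5 : z / √p = (√p)⁻¹ * z := by ring
      have h6 : (z, p) ∈ S ↔ (√p)⁻¹ * z ∈ A := by
        simp only [hS, Set.mem_ofPred_eq, h5, hp.1, hp.2, true_and]
      have h7 : z ∈ (fun z => (√p)⁻¹ * z) ⁻¹' (A ∩ Set.Icc (-1) 1) ↔
          z ^ 2 ≤ p ∧ (z, p) ∈ S := by
        rw [Set.mem_preimage, Set.mem_inter_iff, Set.mem_Icc, h4, h6, and_comm]
      simp only [Set.indicator, Set.mem_Ici, Pi.one_apply]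
      exact (ite_and ..).symm.trans (if_congr h7.symm rfl rfl)
    · rw [Set.indicator_of_notMem hp]
      convert lintegral_zero with z
      have : (z, p) ∉ S := fun h => hp ⟨h.1, h.2.1⟩
      simp [Set.indicator, this]
  · refine Measurable.aemeasurable ?_
    have : (Function.uncurry fun x y => (Set.Ici (x ^ 2)).indicator
        (fun p => S.indicator (1 : ℝ × ℝ → ENNReal) (x, p)) y) =
        ({q : ℝ × ℝ | q.1 ^ 2 ≤ q.2} ∩ S).indicator 1 := by
      ext q
      have h6 : q ∈ {q : ℝ × ℝ | q.1 ^ 2 ≤ q.2} ∩ S ↔ q.1 ^ 2 ≤ q.2 ∧ (q.1, q.2) ∈ S := Iff.rfl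
      simp only [Function.uncurry, Set.indicator, Set.mem_Ici, Pi.one_apply]
      exact (ite_and ..).symm.trans (if_congr h6.symm rfl rfl)
    rw [this]
    exact measurable_one.indicator
      ((measurableSet_le (by fun_prop) (by fun_prop)).inter hSm)

/-- `toSphere` is the dimension `3` times the volume of the cone over the set. An orthonormal basis
starting with `w` rotates that cone to the one in `volume_cone`. The constant stays unevaluated,
since normalization will determine it. -/
theorem toSphere_inner {w : E3} (hw : ‖w‖ = 1) {A : Set ℝ} (hA : MeasurableSet A) :
    (volume : Measure E3).toSphere ((fun v => inner ℝ w (v : E3)) ⁻¹' A) =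
      3 * (ENNReal.ofReal Real.pi * ∫⁻ p in Set.Ioo (0 : ℝ) 1, ENNReal.ofReal √p) *
        volume (A ∩ Set.Icc (-1) 1) := by
  have hm : Measurable fun v : Metric.sphere (0 : E3) 1 => inner ℝ w (v : E3) := by fun_prop
  obtain ⟨b, hb⟩ := Orthonormal.exists_orthonormalBasis_extension_of_card_eq
    (𝕜 := ℝ) (E := E3) (ι := Fin 3) (by simp) (v := fun _ => w) (s := {0}) (by
      constructor
      · rintro ⟨i, hi⟩; simp [hw]
      · rintro ⟨i, hi⟩ ⟨j, hj⟩ hij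
        simp only [Set.mem_singleton_iff] at hi hj
        subst hi; subst hj; exact absurd rfl hij)
  have hb0 : b 0 = w := hb 0 (by simp)
  rw [Measure.toSphere_apply' _ (hm hA), mul_assoc, ← volume_cone hA,
    ← b.measurePreserving_repr.measure_preimage
      (s := {x : E3 | 0 < ‖x‖ ∧ ‖x‖ < 1 ∧ x 0 / ‖x‖ ∈ A})]
  · congr 1
    · simp
    congr 1
    ext x
    simp only [Set.mem_smul, Set.mem_Ioo, Set.mem_image, Set.mem_ofPred_eq, Set.mem_preimage,
      LinearIsometryEquiv.norm_map, OrthonormalBasis.repr_apply_apply, hb0]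
    constructor
    · rintro ⟨r, ⟨hr0, hr1⟩, y, ⟨v, hv, rfl⟩, rfl⟩
      have hv1 : ‖(v : E3)‖ = 1 := by simp
      rw [norm_smul, hv1, mul_one, Real.norm_of_nonneg hr0.le, inner_smul_right,
        mul_div_cancel_left₀ _ hr0.ne']
      exact ⟨hr0, hr1, hv⟩
    · rintro ⟨h0, h1, h2⟩
      refine ⟨‖x‖, ⟨h0, h1⟩, ‖x‖⁻¹ • x, ⟨⟨‖x‖⁻¹ • x, ?_⟩, ?_, rfl⟩, ?_⟩
      · simp [norm_smul, h0.ne']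
      · simp only [inner_smul_right]
        rwa [inv_mul_eq_div]
      · rw [smul_smul, mul_inv_cancel₀ h0.ne', one_smul]
  · refine MeasurableSet.nullMeasurableSet ?_
    have h3 : Measurable fun x : E3 => x 0 / ‖x‖ := by fun_prop
    exact (measurableSet_lt measurable_const measurable_norm).inter
      ((measurableSet_lt measurable_norm measurable_const).inter (h3 hA))

instance : IsProbabilityMeasure uniformSphere := by
  have h : IsProbabilityMeasure (((volume : Measure E3).toSphere Set.univ)⁻¹ •
      (volume : Measure E3).toSphere) := by
    have : NeZero (volume : Measure E3).toSphere := ⟨Measure.toSphere_ne_zero _⟩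
    infer_instance
  exact Measure.isProbabilityMeasure_map (by fun_prop)

/-- **Archimedes' hat-box theorem**: the component of a uniformly distributed unit vector along a
fixed direction is uniformly distributed on `[-1, 1]`. -/
theorem uniformSphere_inner {w : E3} (hw : ‖w‖ = 1) {A : Set ℝ} (hA : MeasurableSet A) :
    uniformSphere ((fun v => inner ℝ w v) ⁻¹' A) = 2⁻¹ * volume (A ∩ Set.Icc (-1) 1) := by
  have hm : Measurable fun v : E3 => inner ℝ w v := by fun_prop
  have key : ∀ {B : Set ℝ}, MeasurableSet B → uniformSphere ((fun v => inner ℝ w v) ⁻¹' B) =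
      (((volume : Measure E3).toSphere Set.univ)⁻¹ *
        (3 * (ENNReal.ofReal Real.pi * ∫⁻ p in Set.Ioo (0 : ℝ) 1, ENNReal.ofReal √p))) *
        volume (B ∩ Set.Icc (-1) 1) := by
    intro B hB
    rw [mul_assoc, ← toSphere_inner hw hB, uniformSphere,
      Measure.map_apply measurable_subtype_coe (hm hB), Measure.smul_apply, smul_eq_mul]
    rfl
  rw [key hA]
  congr 1
  -- Total mass `1` against the length `2` of `[-1, 1]` forces the constant to be `1/2`.
  have h1 := key MeasurableSet.univ
  rw [Set.univ_inter, Real.volume_Icc] at h1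
  rw [Set.preimage_univ, measure_univ, show ENNReal.ofReal (1 - -1) = 2 by norm_num] at h1
  exact ENNReal.eq_inv_of_mul_eq_one_left h1.symm

theorem map_inner_uniformSphere {w : E3} (hw : ‖w‖ = 1) :
    uniformSphere.map (fun v => inner ℝ w v) =
      (2⁻¹ : ENNReal) • volume.restrict (Set.Icc (-1 : ℝ) 1) := by
  ext A hA
  rw [Measure.map_apply (by fun_prop) hA, Measure.smul_apply, Measure.restrict_apply hA,
    smul_eq_mul, ← uniformSphere_inner hw hA]

theorem ae_norm_eq_one_uniformSphere : ∀ᵐ v ∂uniformSphere, ‖v‖ = 1 := by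
  rw [uniformSphere, ae_map_iff (by fun_prop) (measurableSet_eq_fun measurable_norm (by fun_prop))]
  exact Filter.Eventually.of_forall fun v => by simp

/-! ### Mixing uniform laws over the transmit orientation -/

/-- The inner product of a uniformly distributed unit vector with `b ≠ 0` is uniformly distributed
on `[-‖b‖, ‖b‖]`. -/
theorem uniformSphere_inner_of_ne_zero {b : E3} (hb : b ≠ 0) {A : Set ℝ} (hA : MeasurableSet A) :
    uniformSphere ((fun v => inner ℝ v b) ⁻¹' A) =
      ∫⁻ x in A, (Set.Icc (-‖b‖) ‖b‖).indicator (fun _ => ENNReal.ofReal (2 * ‖b‖)⁻¹) x := by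
  have hb0 : 0 < ‖b‖ := norm_pos_iff.2 hb
  have hset : (fun v => inner ℝ v b) ⁻¹' A =
      (fun v => inner ℝ (‖b‖⁻¹ • b) v) ⁻¹' ((fun z => ‖b‖ * z) ⁻¹' A) := by
    ext v
    simp only [Set.mem_preimage, inner_smul_left, conj_trivial]
    rw [mul_inv_cancel_left₀ hb0.ne', real_inner_comm]
  rw [hset, uniformSphere_inner (by simp [norm_smul, hb0.ne'])
    ((measurable_const_mul ‖b‖) hA), lintegral_indicator_const measurableSet_Icc,
    Measure.restrict_apply measurableSet_Icc]
  have hset2 : (fun z => ‖b‖ * z) ⁻¹' A ∩ Set.Icc (-1) 1 =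
      (fun z => ‖b‖ * z) ⁻¹' (Set.Icc (-‖b‖) ‖b‖ ∩ A) := by
    ext z
    have h : -‖b‖ ≤ ‖b‖ * z ∧ ‖b‖ * z ≤ ‖b‖ ↔ -1 ≤ z ∧ z ≤ 1 := by
      rw [← abs_le, ← abs_le, abs_mul, abs_norm, mul_le_iff_le_one_right hb0]
    simp only [Set.mem_inter_iff, Set.mem_preimage, Set.mem_Icc, h]
    exact and_comm
  rw [hset2, Real.volume_preimage_mul_left hb0.ne', ← mul_assoc, abs_of_pos (inv_pos.2 hb0),
    mul_inv, ENNReal.ofReal_mul (by norm_num), ENNReal.ofReal_inv_of_pos (by norm_num : (0:ℝ) < 2)]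
  simp

/-- The law of `⟪v, b u⟫` for independent uniformly distributed unit vectors `u`, `v`, when the norm
of `b u` depends on the component of `u` along the unit vector `d` only. -/
theorem map_inner_prod_uniformSphere {d : E3} (hd : ‖d‖ = 1) {b : E3 → E3} (hb : Measurable b)
    {β : ℝ → ℝ} (hβ : Measurable β) (hbβ : ∀ u, ‖u‖ = 1 → ‖b u‖ = β (inner ℝ d u))
    (hpos : ∀ᵐ c ∂(volume.restrict (Set.Icc (-1 : ℝ) 1)), 0 < β c) {f : ℝ → ℝ}
    (hf : ∀ x, x ≠ 0 → 2⁻¹ * ∫⁻ c in Set.Icc (-1 : ℝ) 1,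
      {c | |x| ≤ β c}.indicator (fun c => ENNReal.ofReal (2 * β c)⁻¹) c = ENNReal.ofReal (f x)) :
    (uniformSphere.prod uniformSphere).map (fun p => inner ℝ p.2 (b p.1)) =
      volume.withDensity (fun x => ENNReal.ofReal (f x)) := by
  ext A hA
  have hm : Measurable fun p : E3 × E3 => (inner ℝ p.2 (b p.1) : ℝ) := by fun_prop
  set G : ℝ × ℝ → ENNReal := {q : ℝ × ℝ | |q.2| ≤ β q.1}.indicator
    (fun q => ENNReal.ofReal (2 * β q.1)⁻¹) with hG
  have hGm : Measurable G := by
    refine Measurable.indicator (by fun_prop) (measurableSet_le ?_ (by fun_prop))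
    exact measurable_snd.abs
  have hdm : Measurable fun u : E3 => (inner ℝ d u : ℝ) := by fun_prop
  have hposu : ∀ᵐ u ∂uniformSphere, 0 < β (inner ℝ d u) := by
    refine ae_of_ae_map hdm.aemeasurable (p := fun c => 0 < β c) ?_
    rw [map_inner_uniformSphere hd]
    exact Measure.ae_smul_measure hpos _
  have hGin : Measurable fun c => ∫⁻ x in A, G (c, x) := hGm.lintegral_prod_right'
  rw [Measure.map_apply hm hA, Measure.prod_apply (hm hA), withDensity_apply _ hA]
  calc ∫⁻ u, uniformSphere (Prod.mk u ⁻¹' ((fun p : E3 × E3 => (inner ℝ p.2 (b p.1) : ℝ)) ⁻¹' A))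
        ∂uniformSphere
      = ∫⁻ u, (fun c => ∫⁻ x in A, G (c, x)) (inner ℝ d u) ∂uniformSphere := by
        refine lintegral_congr_ae ?_
        filter_upwards [ae_norm_eq_one_uniformSphere, hposu] with u hu hβu
        have hne : b u ≠ 0 := norm_pos_iff.1 (by rwa [hbβ u hu])
        refine (uniformSphere_inner_of_ne_zero hne hA).trans (lintegral_congr fun x => ?_)
        have : x ∈ Set.Icc (-‖b u‖) ‖b u‖ ↔ (inner ℝ d u, x) ∈ {q : ℝ × ℝ | |q.2| ≤ β q.1} := by
          rw [Set.mem_Icc, ← abs_le, hbβ u hu]; rfl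
        rw [hG]
        by_cases hx : x ∈ Set.Icc (-‖b u‖) ‖b u‖
        · rw [Set.indicator_of_mem hx, Set.indicator_of_mem (this.1 hx), hbβ u hu]
        · rw [Set.indicator_of_notMem hx, Set.indicator_of_notMem (mt this.2 hx)]
    _ = 2⁻¹ * ∫⁻ c in Set.Icc (-1 : ℝ) 1, ∫⁻ x in A, G (c, x) := by
        rw [← lintegral_map hGin hdm, map_inner_uniformSphere hd, lintegral_smul_measure,
          smul_eq_mul]
    _ = ∫⁻ x in A, 2⁻¹ * ∫⁻ c in Set.Icc (-1 : ℝ) 1, G (c, x) := by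
        rw [lintegral_lintegral_swap (by exact hGm.aemeasurable),
          lintegral_const_mul _ hGm.lintegral_prod_left']
    _ = ∫⁻ x in A, ENNReal.ofReal (f x) := by
        refine lintegral_congr_ae (ae_restrict_of_ae ?_)
        filter_upwards [Measure.ae_ne volume (0 : ℝ)] with x hx
        exact hf x hx

/-! ### Field norms and explicit densities -/

theorem norm_bNF {d u : E3} (hd : ‖d‖ = 1) (hu : ‖u‖ = 1) :
    ‖bNF d u‖ = √(3 * inner ℝ d u ^ 2 + 1) / 2 := by
  have h : ‖(3 * inner ℝ d u) • d - u‖ ^ 2 = 3 * inner ℝ d u ^ 2 + 1 := by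
    rw [norm_sub_sq_real, norm_smul, hd, hu, inner_smul_left, mul_one, Real.norm_eq_abs, sq_abs]
    simp only [conj_trivial]
    ring
  rw [bNF, norm_smul, ← h, Real.sqrt_sq (norm_nonneg _)]
  norm_num
  ring

theorem norm_bFF {d u : E3} (hd : ‖d‖ = 1) (hu : ‖u‖ = 1) :
    ‖bFF d u‖ = √(1 - inner ℝ d u ^ 2) := by
  have h : ‖u - (inner ℝ d u : ℝ) • d‖ ^ 2 = 1 - inner ℝ d u ^ 2 := by
    rw [norm_sub_sq_real, norm_smul, hd, hu, inner_smul_right, mul_one, Real.norm_eq_abs, sq_abs,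
      real_inner_comm]
    ring
  rw [bFF, ← h, Real.sqrt_sq (norm_nonneg _)]

theorem lintegral_Icc_of_even {g : ℝ → ENNReal} (hg : ∀ c, g (-c) = g c) :
    2⁻¹ * ∫⁻ c in Set.Icc (-1 : ℝ) 1, g c = ∫⁻ c in Set.Icc (0 : ℝ) 1, g c := by
  have h1 : ∫⁻ c in Set.Icc (-1 : ℝ) 0, g c = ∫⁻ c in Set.Icc (0 : ℝ) 1, g c := by
    have h := (Measure.measurePreserving_neg (volume : Measure ℝ)).setLIntegral_comp_preimage_emb
      (MeasurableEquiv.neg ℝ).measurableEmbedding g (Set.Icc 0 1)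
    simpa [hg] using h
  have h2 : ∫⁻ c in Set.Icc (-1 : ℝ) 1, g c =
      (∫⁻ c in Set.Icc (-1 : ℝ) 0, g c) + ∫⁻ c in Set.Icc (0 : ℝ) 1, g c := by
    rw [setLIntegral_congr (Ioc_ae_eq_Icc (a := (0 : ℝ)) (b := 1)).symm,
      ← lintegral_union measurableSet_Ioc, Set.Icc_union_Ioc_eq_Icc (by norm_num) (by norm_num)]
    rw [Set.disjoint_left]
    intro x hx hx'
    exact absurd hx.2 (not_le.2 hx'.1)
  rw [h2, h1, ← two_mul, ← mul_assoc, ENNReal.inv_mul_cancel (by simp) (by simp), one_mul]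

theorem lintegral_Icc_ofReal_of_hasDerivAt {F g : ℝ → ℝ} {a b : ℝ} (hab : a ≤ b)
    (hF : ∀ x ∈ Set.Icc a b, HasDerivAt F (g x) x) (hg : ContinuousOn g (Set.Icc a b))
    (hg0 : ∀ x ∈ Set.Icc a b, 0 ≤ g x) :
    ∫⁻ x in Set.Icc a b, ENNReal.ofReal (g x) = ENNReal.ofReal (F b - F a) := by
  rw [← ofReal_integral_eq_lintegral_ofReal hg.integrableOn_Icc
    ((ae_restrict_iff' measurableSet_Icc).2 (Eventually.of_forall hg0)),
    integral_Icc_eq_integral_Ioc, ← intervalIntegral.integral_of_le hab,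
    intervalIntegral.integral_eq_sub_of_hasDerivAt]
  · rwa [Set.uIcc_of_le hab]
  · exact ContinuousOn.intervalIntegrable (by rwa [Set.uIcc_of_le hab])

theorem arsinh_sqrt_sq_sub_one {y : ℝ} (hy : 1 ≤ y) :
    Real.arsinh √(y ^ 2 - 1) = Real.arcosh y := by
  rw [← Real.sinh_arcosh hy, Real.arsinh_sinh]

theorem arcosh_two : Real.arcosh 2 = Real.arsinh √3 := by
  rw [← arsinh_sqrt_sq_sub_one (by norm_num)]; norm_num

theorem arsinh_sqrt_three_pos : 0 < Real.arsinh √3 := Real.arsinh_pos_iff.2 (by positivity)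

/-- One formula covers the three branches: the square root of a negative number is `0`, which gives
the plateau `|x| ≤ 1/2`, and the `min` cancels `arsinh √3` for `|x| ≥ 1`. Continuity and the maximum
at `0` can be read off from it. -/
theorem pdfJNF_eq (x : ℝ) :
    pdfJNF x = (Real.arsinh √3 - Real.arsinh √(4 * min (x ^ 2) 1 - 1)) / √3 := by
  have h0 := arsinh_sqrt_three_pos
  have h3 : 0 < √3 := by positivity
  unfold pdfJNF
  rw [arcosh_two]
  split_ifs with h1 h2
  · have : 4 * min (x ^ 2) 1 - 1 ≤ 0 := by
      have : x ^ 2 ≤ (1 / 2) ^ 2 := by rw [← sq_abs]; gcongr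
      linarith [min_le_left (x ^ 2) 1]
    rw [Real.sqrt_eq_zero_of_nonpos this, Real.arsinh_zero]
    field_simp
    ring
  · rw [min_eq_left (by rw [← sq_abs]; nlinarith [abs_nonneg x]),
      ← arsinh_sqrt_sq_sub_one (by linarith [not_le.1 h1]), mul_pow, sq_abs]
    norm_num
    field_simp
  · rw [min_eq_right (by rw [← sq_abs]; nlinarith [abs_nonneg x])]
    norm_num

/-- `Real.arcsin` is constantly `π / 2` beyond `1`, so the indicator is redundant. -/
theorem pdfJFF_eq (x : ℝ) : pdfJFF x = (Real.pi / 2 - Real.arcsin |x|) / 2 := by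
  unfold pdfJFF
  by_cases hx : |x| ≤ 1
  · rw [Set.indicator_of_mem (by rwa [Set.mem_Icc, ← abs_le])]
    simp only [Pi.one_apply]
    ring
  · rw [Set.indicator_of_notMem (by rwa [Set.mem_Icc, ← abs_le]),
      Real.arcsin_of_one_le (le_of_not_ge hx)]
    ring

theorem continuous_pdfJNF : Continuous pdfJNF := by
  rw [funext pdfJNF_eq]
  have : Continuous fun x : ℝ => Real.arsinh √(4 * min (x ^ 2) 1 - 1) :=
    Real.continuous_arsinh.comp (by fun_prop)
  fun_prop

theorem continuous_pdfJFF : Continuous pdfJFF := by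
  rw [funext pdfJFF_eq]
  have : Continuous fun x : ℝ => Real.arcsin |x| := Real.continuous_arcsin.comp (by fun_prop)
  fun_prop

theorem pdfJNF_zero_pos : 0 < pdfJNF 0 := by
  have h0 : √(4 * min ((0 : ℝ) ^ 2) 1 - 1) = 0 := Real.sqrt_eq_zero_of_nonpos (by norm_num)
  rw [pdfJNF_eq, h0, Real.arsinh_zero, sub_zero]
  exact div_pos arsinh_sqrt_three_pos (by positivity)

theorem pdfJFF_zero_pos : 0 < pdfJFF 0 := by
  rw [pdfJFF_eq]; simp [Real.pi_pos]

theorem pdfJNF_le_zero (x : ℝ) : pdfJNF x ≤ pdfJNF 0 := by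
  have h0 : √(4 * min ((0 : ℝ) ^ 2) 1 - 1) = 0 := Real.sqrt_eq_zero_of_nonpos (by norm_num)
  rw [pdfJNF_eq, pdfJNF_eq, h0]
  gcongr
  exact Real.sqrt_nonneg _

theorem pdfJFF_le_zero (x : ℝ) : pdfJFF x ≤ pdfJFF 0 := by
  rw [pdfJFF_eq, pdfJFF_eq]
  have h : Real.arcsin |0| ≤ Real.arcsin |x| :=
    Real.monotone_arcsin (abs_zero.trans_le (abs_nonneg x))
  exact div_le_div_of_nonneg_right (sub_le_sub_left h _) zero_le_two

/-- For `c ≥ 0` the constraint `|x| ≤ β c` reads `m ≤ c` with `m = √(4x² - 1) / √3`, which is `0` on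
the plateau and at least `1` once `|x| ≥ 1`. On `[m, 1]` the integrand has antiderivative `arsinh
(√3 c) / √3`. -/
theorem lintegral_density_near (x : ℝ) :
    2⁻¹ * ∫⁻ c in Set.Icc (-1 : ℝ) 1, {c : ℝ | |x| ≤ √(3 * c ^ 2 + 1) / 2}.indicator
      (fun c => ENNReal.ofReal (2 * (√(3 * c ^ 2 + 1) / 2))⁻¹) c = ENNReal.ofReal (pdfJNF x) := by
  have h3 : 0 < √3 := by positivity
  rw [lintegral_Icc_of_even (fun c => by simp [Set.indicator])]
  have hmem : ∀ c : ℝ, 0 ≤ c → (|x| ≤ √(3 * c ^ 2 + 1) / 2 ↔ √(4 * x ^ 2 - 1) / √3 ≤ c) := by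
    intro c hc
    rw [div_le_iff₀ h3, Real.sqrt_le_left (by positivity), mul_pow c, Real.sq_sqrt (by norm_num),
      le_div_iff₀ (by norm_num), Real.le_sqrt (by positivity), mul_pow, sq_abs]
    · constructor <;> intro h <;> linarith
    · positivity
  have hm0 : 0 ≤ √(4 * x ^ 2 - 1) / √3 := by positivity
  set m := √(4 * x ^ 2 - 1) / √3 with hm
  have hset : ∫⁻ c in Set.Icc (0 : ℝ) 1, {c : ℝ | |x| ≤ √(3 * c ^ 2 + 1) / 2}.indicator
      (fun c => ENNReal.ofReal (2 * (√(3 * c ^ 2 + 1) / 2))⁻¹) c =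
      ∫⁻ c in Set.Icc m 1, ENNReal.ofReal (√(1 + (√3 * c) ^ 2))⁻¹ := by
    rw [← lintegral_indicator measurableSet_Icc, ← lintegral_indicator measurableSet_Icc]
    refine lintegral_congr fun c => ?_
    by_cases hc : c ∈ Set.Icc m 1
    · have hc0 : 0 ≤ c := hm0.trans hc.1
      rw [Set.indicator_of_mem hc, Set.indicator_of_mem (Set.mem_Icc.2 ⟨hc0, hc.2⟩),
        Set.indicator_of_mem (by exact (hmem c hc0).2 hc.1), mul_pow, Real.sq_sqrt (by norm_num),
        mul_div_cancel₀ _ (two_ne_zero' ℝ), add_comm]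
    · rw [Set.indicator_of_notMem hc]
      by_cases hc1 : c ∈ Set.Icc (0 : ℝ) 1
      · rw [Set.indicator_of_mem hc1, Set.indicator_of_notMem]
        exact fun h => hc ⟨(hmem c hc1.1).1 h, hc1.2⟩
      · rw [Set.indicator_of_notMem hc1]
  rw [hset, pdfJNF_eq]
  rcases le_total (x ^ 2) 1 with hx | hx
  · have hm1 : m ≤ 1 := by
      rw [hm, div_le_one h3]
      exact Real.sqrt_le_sqrt (by linarith)
    rw [lintegral_Icc_ofReal_of_hasDerivAt (F := fun c => Real.arsinh (√3 * c) / √3) hm1,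
      min_eq_left hx]
    · congr 1
      rw [hm, mul_div_cancel₀ _ h3.ne', mul_one]
      ring
    · intro c _
      refine (((hasDerivAt_id c).const_mul √3).arsinh.div_const √3).congr_deriv ?_
      simp only [id, smul_eq_mul, mul_one]
      field_simp
    · exact Continuous.continuousOn (Continuous.inv₀ (by fun_prop) fun c => by positivity)
    · intro c _; positivity
  · have hm1 : 1 ≤ m := by
      rw [hm, one_le_div h3]
      exact Real.sqrt_le_sqrt (by linarith)
    rw [min_eq_right hx, show (4 : ℝ) * 1 - 1 = 3 by norm_num, sub_self, zero_div,
      ENNReal.ofReal_zero]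
    refine setLIntegral_measure_zero _ _ ?_
    rw [Real.volume_Icc, ENNReal.ofReal_of_nonpos (by linarith)]

/-- The range of integration is `[0, √(1 - x²)]`, with antiderivative `arcsin c / 2`. Excluding `x =
0` keeps the upper limit below `1`, away from the singularity of the integrand. -/
theorem lintegral_density_far {x : ℝ} (hx0 : x ≠ 0) :
    2⁻¹ * ∫⁻ c in Set.Icc (-1 : ℝ) 1, {c : ℝ | |x| ≤ √(1 - c ^ 2)}.indicator
      (fun c => ENNReal.ofReal (2 * √(1 - c ^ 2))⁻¹) c = ENNReal.ofReal (pdfJFF x) := by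
  have hx2 : 0 < x ^ 2 := by positivity
  rw [lintegral_Icc_of_even (fun c => by simp [Set.indicator]), pdfJFF_eq]
  have hmem : ∀ c : ℝ, |x| ≤ √(1 - c ^ 2) ↔ c ^ 2 ≤ 1 - x ^ 2 := by
    intro c
    rw [Real.le_sqrt' (abs_pos.2 hx0), sq_abs]
    constructor <;> intro h <;> linarith
  rcases le_total |x| 1 with hx | hx
  · have hx1 : x ^ 2 ≤ 1 := by rw [← sq_abs]; exact pow_le_one₀ (abs_nonneg x) hx
    set m := √(1 - x ^ 2) with hm
    have hm0 : 0 ≤ m := Real.sqrt_nonneg _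
    have hm1 : m < 1 := by rw [hm, Real.sqrt_lt' one_pos]; linarith
    have hset : ∫⁻ c in Set.Icc (0 : ℝ) 1, {c : ℝ | |x| ≤ √(1 - c ^ 2)}.indicator
        (fun c => ENNReal.ofReal (2 * √(1 - c ^ 2))⁻¹) c =
        ∫⁻ c in Set.Icc 0 m, ENNReal.ofReal (2 * √(1 - c ^ 2))⁻¹ := by
      rw [← lintegral_indicator measurableSet_Icc, ← lintegral_indicator measurableSet_Icc]
      refine lintegral_congr fun c => ?_
      by_cases hc : c ∈ Set.Icc 0 m
      · rw [Set.indicator_of_mem hc,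
          Set.indicator_of_mem (Set.mem_Icc.2 ⟨hc.1, hc.2.trans hm1.le⟩),
          Set.indicator_of_mem]
        exact (hmem c).2 ((Real.le_sqrt hc.1 (by linarith)).1 hc.2)
      · rw [Set.indicator_of_notMem hc]
        by_cases hc1 : c ∈ Set.Icc (0 : ℝ) 1
        · rw [Set.indicator_of_mem hc1, Set.indicator_of_notMem]
          exact fun h => hc ⟨hc1.1, Real.le_sqrt_of_sq_le ((hmem c).1 h)⟩
        · rw [Set.indicator_of_notMem hc1]
    have hpos : ∀ c ∈ Set.Icc 0 m, 0 < √(1 - c ^ 2) := by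
      intro c hc
      refine Real.sqrt_pos.2 ?_
      nlinarith [hc.1, hc.2]
    rw [hset, lintegral_Icc_ofReal_of_hasDerivAt (F := fun c => Real.arcsin c / 2) hm0]
    · congr 1
      rw [Real.arcsin_zero, zero_div, sub_zero, hm, ← sq_abs x,
        ← Real.arccos_eq_arcsin (abs_nonneg x), Real.arccos]
    · intro c hc
      refine ((Real.hasDerivAt_arcsin (x := c) (by linarith [hc.1])
        (by linarith [hc.2])).div_const 2).congr_deriv ?_
      rw [mul_inv]; ring
    · refine ContinuousOn.inv₀ (by fun_prop) fun c hc => ?_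
      have := hpos c hc
      positivity
    · intro c hc; positivity
  · rw [Real.arcsin_of_one_le hx, sub_self, zero_div, ENNReal.ofReal_zero,
      ← lintegral_indicator measurableSet_Icc, lintegral_eq_zero_iff']
    · have hx1 : 1 ≤ x ^ 2 := by rw [← sq_abs]; exact one_le_pow₀ hx
      -- When `|x| = 1` the constraint still admits `c = 0`, a null set.
      filter_upwards [Measure.ae_ne volume (0 : ℝ)] with c hc
      have : c ∉ {c : ℝ | |x| ≤ √(1 - c ^ 2)} := fun h => by
        have h1 := (hmem c).1 h
        have : 0 < c ^ 2 := by positivity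
        linarith
      rw [Set.indicator_apply, Set.indicator_of_notMem this, ite_self, Pi.zero_apply]
    · refine Measurable.aemeasurable (Measurable.indicator (Measurable.indicator (by fun_prop)
        (measurableSet_le (by fun_prop) (by fun_prop))) measurableSet_Icc)

/-! ### Both regions at once: the law of the alignment factor -/

theorem Region.continuous_pdf (R : Region) : Continuous R.pdf := by
  cases R
  exacts [continuous_pdfJNF, continuous_pdfJFF]

theorem Region.pdf_zero_pos (R : Region) : 0 < R.pdf 0 := by
  cases R
  exacts [pdfJNF_zero_pos, pdfJFF_zero_pos]

theorem Region.pdf_le_zero (R : Region) (x : ℝ) : R.pdf x ≤ R.pdf 0 := by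
  cases R
  exacts [pdfJNF_le_zero x, pdfJFF_le_zero x]

theorem Region.continuous_J (R : Region) (d : E3) :
    Continuous fun p : E3 × E3 => R.J d p.1 p.2 := by
  cases R
  · unfold Region.J JNF bNF; fun_prop
  · unfold Region.J JFF bFF; fun_prop

theorem Region.map_J_prod_uniformSphere (R : Region) {d : E3} (hd : ‖d‖ = 1) :
    (uniformSphere.prod uniformSphere).map (fun p => R.J d p.1 p.2) =
      volume.withDensity (fun x => ENNReal.ofReal (R.pdf x)) := by
  cases R
  · refine map_inner_prod_uniformSphere hd (b := bNF d) (by unfold bNF; fun_prop)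
      (β := fun c => √(3 * c ^ 2 + 1) / 2) (by fun_prop) (fun u hu => norm_bNF hd hu)
      (Eventually.of_forall fun c => by positivity) fun x _ => lintegral_density_near x
  · refine map_inner_prod_uniformSphere hd (b := bFF d) (by unfold bFF; fun_prop)
      (β := fun c => √(1 - c ^ 2)) (by fun_prop) (fun u hu => norm_bFF hd hu) ?_
      fun x hx => lintegral_density_far hx
    refine (ae_restrict_iff' measurableSet_Icc).2 ?_
    filter_upwards [Measure.ae_ne volume (1 : ℝ), Measure.ae_ne volume (-1 : ℝ)] with c h1 h2 hc
    have h3 : c < 1 := lt_of_le_of_ne hc.2 h1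
    have h4 : -1 < c := lt_of_le_of_ne hc.1 h2.symm
    exact Real.sqrt_pos.2 (by nlinarith)

/-- The law of the alignment factor of a region. -/
theorem Region.map_J {Ω : Type*} [MeasurableSpace Ω] {μ : Measure Ω} [IsProbabilityMeasure μ]
    {oTx oRx : Ω → E3} (hTx : HasLaw oTx uniformSphere μ) (hRx : HasLaw oRx uniformSphere μ)
    (hindep : IndepFun oTx oRx μ) {d : E3} (hd : ‖d‖ = 1) (R : Region) :
    μ.map (fun ω => R.J d (oTx ω) (oRx ω)) =
      volume.withDensity (fun x => ENNReal.ofReal (R.pdf x)) := by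
  have h := (indepFun_iff_map_prod_eq_prod_map_map hTx.aemeasurable hRx.aemeasurable).1 hindep
  rw [hTx.map_eq, hRx.map_eq] at h
  rw [← R.map_J_prod_uniformSphere hd, ← h, AEMeasurable.map_map_of_aemeasurable
    (R.continuous_J d).measurable.aemeasurable (hTx.aemeasurable.prodMk hRx.aemeasurable)]
  rfl

/-! ### Optimal orientations and uniform approximation of the channel -/

theorem JNF_eq (d u v : E3) : JNF d u v = inner ℝ v d * inner ℝ d u - JFF d u v / 2 := by
  simp only [JNF, bNF, JFF, bFF, inner_smul_right, inner_sub_right]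
  ring

theorem channel_eq (α : ℂ) (kr : ℝ) (d u v : E3) :
    channel α kr d u v = α * ((1 / (kr : ℂ) ^ 3 + Complex.I / (kr : ℂ) ^ 2) *
        ((inner ℝ v d * inner ℝ d u : ℝ) : ℂ) +
      (1 / (2 * (kr : ℂ)) - (1 / (kr : ℂ) ^ 3 + Complex.I / (kr : ℂ) ^ 2) / 2) *
        (JFF d u v : ℂ)) := by
  rw [channel, JNF_eq]
  push_cast
  ring

/-- Split `u` and `v` into parts along and transverse to `d`. The projection is idempotent, so `JFF`
is the inner product of the transverse parts. Cauchy–Schwarz and two uses of `2ab ≤ a² + b²` bound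
the sum by `(‖u‖² + ‖v‖²) / 2 = 1`. -/
theorem abs_inner_mul_inner_add_abs_JFF_le_one {d u v : E3} (hd : ‖d‖ = 1) (hu : ‖u‖ = 1)
    (hv : ‖v‖ = 1) : |inner ℝ v d * inner ℝ d u| + |JFF d u v| ≤ 1 := by
  have h1 : JFF d u v = inner ℝ (bFF d v) (bFF d u) := by
    have h : inner ℝ d d = (1 : ℝ) := by rw [real_inner_self_eq_norm_sq, hd]; norm_num
    simp only [JFF, bFF, inner_sub_right, inner_sub_left, inner_smul_left, inner_smul_right, h,
      conj_trivial, real_inner_comm d v]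
    ring
  have h2 := abs_real_inner_le_norm (bFF d v) (bFF d u)
  have hsq : ∀ w : E3, ‖w‖ = 1 → ‖bFF d w‖ ^ 2 = 1 - inner ℝ d w ^ 2 := by
    intro w hw
    rw [norm_bFF hd hw, Real.sq_sqrt]
    have := abs_real_inner_le_norm d w
    rw [hd, hw, mul_one] at this
    rw [← sq_abs]
    nlinarith [abs_nonneg (inner ℝ d w)]
  rw [h1, abs_mul, real_inner_comm d v]
  nlinarith [sq_nonneg (|inner ℝ d v| - |inner ℝ d u|), sq_nonneg (‖bFF d v‖ - ‖bFF d u‖),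
    hsq u hu, hsq v hv, sq_abs (inner ℝ d v), sq_abs (inner ℝ d u)]

theorem abs_JFF_le_one {d u v : E3} (hd : ‖d‖ = 1) (hu : ‖u‖ = 1) (hv : ‖v‖ = 1) :
    |JFF d u v| ≤ 1 := by
  linarith [abs_inner_mul_inner_add_abs_JFF_le_one hd hu hv, abs_nonneg (inner ℝ v d * inner ℝ d u)]

theorem abs_inner_mul_inner_le_one {d u v : E3} (hd : ‖d‖ = 1) (hu : ‖u‖ = 1) (hv : ‖v‖ = 1) :
    |inner ℝ v d * inner ℝ d u| ≤ 1 := by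
  linarith [abs_inner_mul_inner_add_abs_JFF_le_one hd hu hv, abs_nonneg (JFF d u v)]

theorem exists_norm_eq_one_inner_eq_zero (d : E3) : ∃ e : E3, ‖e‖ = 1 ∧ inner ℝ d e = 0 := by
  have h : 0 < Module.finrank ℝ (ℝ ∙ d)ᗮ := by
    have h1 := Submodule.finrank_add_finrank_orthogonal (ℝ ∙ d)
    have h2 : Module.finrank ℝ (ℝ ∙ d) ≤ 1 := (finrank_span_le_card {d}).trans (by simp)
    have h3 : Module.finrank ℝ E3 = 3 := by simp
    omega
  have := Module.nontrivial_of_finrank_pos h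
  obtain ⟨e, he⟩ := exists_norm_eq (ℝ ∙ d)ᗮ (zero_le_one' ℝ)
  exact ⟨e, by simpa using he, Submodule.mem_orthogonal_singleton_iff_inner_right.1 e.2⟩

/-- The optimal channel magnitude is attained by coaxial or by parallel broadside dipoles. -/
theorem hOptAbs_eq (α : ℂ) (kr : ℝ) {d : E3} (hd : ‖d‖ = 1) :
    hOptAbs α kr d = ‖α‖ * max ‖1 / (kr : ℂ) ^ 3 + Complex.I / (kr : ℂ) ^ 2‖
      ‖1 / (2 * (kr : ℂ)) - (1 / (kr : ℂ) ^ 3 + Complex.I / (kr : ℂ) ^ 2) / 2‖ := by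
  have hch := channel_eq α kr d
  set A : ℂ := 1 / (kr : ℂ) ^ 3 + Complex.I / (kr : ℂ) ^ 2
  set C : ℂ := 1 / (2 * (kr : ℂ)) - A / 2
  have hdd : inner ℝ d d = (1 : ℝ) := by rw [real_inner_self_eq_norm_sq, hd]; norm_num
  obtain ⟨e, he, hde⟩ := exists_norm_eq_one_inner_eq_zero d
  have hA : ‖channel α kr d d d‖ = ‖α‖ * ‖A‖ := by
    rw [hch, JFF, bFF, hdd, one_smul, sub_self, inner_zero_right]
    simp
  have hC : ‖channel α kr d e e‖ = ‖α‖ * ‖C‖ := by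
    simp [hch, JFF, bFF, hde, he]
  have hle : ∀ u v : E3, ‖u‖ = 1 → ‖v‖ = 1 → ‖channel α kr d u v‖ ≤ ‖α‖ * max ‖A‖ ‖C‖ := by
    intro u v hu hv
    rw [hch, norm_mul]
    gcongr
    refine (norm_add_le _ _).trans ?_
    rw [norm_mul, norm_mul, Complex.norm_real, Complex.norm_real, Real.norm_eq_abs,
      Real.norm_eq_abs]
    calc ‖A‖ * |inner ℝ v d * inner ℝ d u| + ‖C‖ * |JFF d u v|
        ≤ max ‖A‖ ‖C‖ * |inner ℝ v d * inner ℝ d u| + max ‖A‖ ‖C‖ * |JFF d u v| := by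
          gcongr
          exacts [le_max_left _ _, le_max_right _ _]
      _ = max ‖A‖ ‖C‖ * (|inner ℝ v d * inner ℝ d u| + |JFF d u v|) := by ring
      _ ≤ max ‖A‖ ‖C‖ :=
          mul_le_of_le_one_right (le_max_of_le_left (norm_nonneg A))
            (abs_inner_mul_inner_add_abs_JFF_le_one hd hu hv)
  have hmax : IsGreatest {η : ℝ | ∃ u v : E3, ‖u‖ = 1 ∧ ‖v‖ = 1 ∧ η = ‖channel α kr d u v‖ ^ 2}
      ((‖α‖ * max ‖A‖ ‖C‖) ^ 2) := by
    constructor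
    · rcases le_total ‖C‖ ‖A‖ with h | h
      · exact ⟨d, d, hd, hd, by rw [hA, max_eq_left h]⟩
      · exact ⟨e, e, he, he, by rw [hC, max_eq_right h]⟩
    · rintro η ⟨u, v, hu, hv, rfl⟩
      gcongr
      exact hle u v hu hv
  rw [hOptAbs, etaOpt, hmax.csSup_eq, Real.sqrt_sq (by positivity)]

theorem inv_pow_three_le_norm (kr : ℝ) :
    1 / kr ^ 3 ≤ ‖1 / (kr : ℂ) ^ 3 + Complex.I / (kr : ℂ) ^ 2‖ := by
  have h : (1 / (kr : ℂ) ^ 3 + Complex.I / (kr : ℂ) ^ 2) =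
      ((1 / kr ^ 3 : ℝ) : ℂ) + ((1 / kr ^ 2 : ℝ) : ℂ) * Complex.I := by
    push_cast; ring
  rw [h]
  refine le_trans ?_ (Complex.re_le_norm _)
  simp [-Complex.ofReal_div, -Complex.ofReal_inv, -Complex.ofReal_pow]

theorem norm_le_inv_pow_add {kr : ℝ} (hkr : 0 < kr) :
    ‖1 / (kr : ℂ) ^ 3 + Complex.I / (kr : ℂ) ^ 2‖ ≤ 1 / kr ^ 3 + 1 / kr ^ 2 := by
  refine (norm_add_le _ _).trans (le_of_eq ?_)
  simp [abs_of_pos hkr]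

theorem hOptAbs_pos {α : ℂ} (hα : α ≠ 0) {kr : ℝ} (hkr : 0 < kr) {d : E3} (hd : ‖d‖ = 1) :
    0 < hOptAbs α kr d := by
  rw [hOptAbs_eq α kr hd]
  refine mul_pos (norm_pos_iff.2 hα) (lt_max_of_lt_left ?_)
  exact lt_of_lt_of_le (by positivity) (inv_pow_three_le_norm kr)

/-- Isolates the dominant term `A * x` from a remainder `z` of relative size `δ`; each region
chooses its own `A`. -/
theorem abs_norm_mul_sub_le (α : ℂ) {A z : ℂ} {x δ : ℝ} (h : ‖z‖ ≤ δ * ‖A‖) :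
    |‖α * (A * (x : ℂ) + z)‖ - ‖α‖ * ‖A‖ * (|x|)| ≤ δ * (‖α‖ * ‖A‖) := by
  have h1 : ‖α‖ * ‖A‖ * |x| = ‖α * (A * (x : ℂ))‖ := by
    rw [norm_mul, norm_mul, Complex.norm_real, Real.norm_eq_abs, mul_assoc]
  rw [h1]
  refine (abs_norm_sub_norm_le _ _).trans ?_
  rw [mul_add, add_sub_cancel_left, norm_mul]
  calc ‖α‖ * ‖z‖ ≤ ‖α‖ * (δ * ‖A‖) := by gcongr
    _ = δ * (‖α‖ * ‖A‖) := by ring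

/-- In the regime of a region, `|h|` is uniformly close to `|h_opt| |J_*|`. -/
theorem Region.eventually_abs_norm_channel_sub_le (R : Region) {d : E3} (hd : ‖d‖ = 1) {δ : ℝ}
    (hδ : 0 < δ) : ∀ᶠ kr in R.regime, 0 < kr ∧ ∀ (α : ℂ) (u v : E3), ‖u‖ = 1 → ‖v‖ = 1 →
      |‖channel α kr d u v‖ - hOptAbs α kr d * (|R.J d u v|)| ≤ δ * hOptAbs α kr d := by
  cases R
  -- `kr < 1` makes `A` the larger coefficient, so that `h_opt` is governed by `A`. It also bounds
  -- the neglected far-field term by `1 / kr ^ 2 = kr * (1 / kr ^ 3)`, at most `δ * ‖A‖` once `kr <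
  -- δ`.
  · have h0 : (0 : ℝ) < min 1 δ := lt_min one_pos hδ
    filter_upwards [Ioo_mem_nhdsGT h0] with kr hkr
    have hk0 : 0 < kr := hkr.1
    have hk1 : kr < 1 := hkr.2.trans_le (min_le_left _ _)
    have hkδ : kr < δ := hkr.2.trans_le (min_le_right _ _)
    refine ⟨hk0, fun α u v hu hv => ?_⟩
    have hB : ‖1 / (2 * (kr : ℂ))‖ = 1 / (2 * kr) := by simp [abs_of_pos hk0]
    have hA := inv_pow_three_le_norm kr
    rw [hOptAbs_eq α kr hd, channel]
    set A : ℂ := 1 / (kr : ℂ) ^ 3 + Complex.I / (kr : ℂ) ^ 2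
    have hCA : ‖1 / (2 * (kr : ℂ)) - A / 2‖ ≤ ‖A‖ := by
      have h1 : 1 / kr ≤ 1 / kr ^ 3 := by
        gcongr
        nlinarith [mul_pos hk0 hk0]
      have h2 : (1 : ℝ) / (2 * kr) = 1 / kr / 2 := by field_simp
      have h3 := norm_sub_le (1 / (2 * (kr : ℂ))) (A / 2)
      have h4 : ‖A / 2‖ = ‖A‖ / 2 := by simp
      linarith
    rw [max_eq_left hCA]
    refine abs_norm_mul_sub_le α ?_
    rw [norm_mul, hB, Complex.norm_real, Real.norm_eq_abs]
    calc 1 / (2 * kr) * |JFF d u v| ≤ 1 / (2 * kr) * 1 := by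
          gcongr
          exact abs_JFF_le_one hd hu hv
      _ ≤ kr * (1 / kr ^ 3) := by
          have h1 : kr * (1 / kr ^ 3) = 1 / kr ^ 2 := by field_simp
          rw [h1, mul_one]
          gcongr
          nlinarith
      _ ≤ δ * ‖A‖ := by gcongr
  -- With `C` the coefficient of `JFF` in `channel_eq`, `‖A‖ ≤ 2 / kr ^ 2` and `‖C‖ ≥ 1 / (4 * kr)`
  -- give `‖A‖ / ‖C‖ ≤ 8 / kr`. This ratio must be at most `1` for `C` to govern `h_opt`, and at
  -- most `δ` for the remainder.
  · filter_upwards [eventually_ge_atTop 8, eventually_ge_atTop (8 / δ)] with kr hk8 hkδ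
    have hk0 : 0 < kr := by linarith
    refine ⟨hk0, fun α u v hu hv => ?_⟩
    have hB : ‖1 / (2 * (kr : ℂ))‖ = 1 / (2 * kr) := by simp [abs_of_pos hk0]
    have hA := norm_le_inv_pow_add hk0
    rw [hOptAbs_eq α kr hd, channel_eq]
    set A : ℂ := 1 / (kr : ℂ) ^ 3 + Complex.I / (kr : ℂ) ^ 2
    have hA2 : ‖A‖ ≤ 2 / kr ^ 2 := by
      have h1 : 1 / kr ^ 3 ≤ 1 / kr ^ 2 := by
        gcongr
        · linarith
        · norm_num
      have h2 : 2 / kr ^ 2 = 1 / kr ^ 2 + 1 / kr ^ 2 := by ring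
      linarith
    have hC : 1 / (4 * kr) ≤ ‖1 / (2 * (kr : ℂ)) - A / 2‖ := by
      have h1 := norm_sub_norm_le (1 / (2 * (kr : ℂ))) (A / 2)
      have h2 : ‖A / 2‖ = ‖A‖ / 2 := by simp
      have h3 : 1 / (4 * kr) + 2 / kr ^ 2 / 2 ≤ 1 / (2 * kr) := by
        rw [← sub_nonneg]
        have : 1 / (2 * kr) - (1 / (4 * kr) + 2 / kr ^ 2 / 2) = (kr - 4) / (4 * kr ^ 2) := by
          field_simp; ring
        rw [this]
        exact div_nonneg (by linarith) (by positivity)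
      linarith
    have hAC : ∀ r : ℝ, 0 < r → 8 / r ≤ kr →
        ‖A‖ ≤ r * ‖1 / (2 * (kr : ℂ)) - A / 2‖ := by
      intro r hr hkr
      have h1 : 2 / kr ^ 2 ≤ r * (1 / (4 * kr)) := by
        rw [div_le_iff₀ hr] at hkr
        rw [mul_one_div, div_le_div_iff₀ (by positivity) (by positivity)]
        nlinarith
      calc ‖A‖ ≤ r * (1 / (4 * kr)) := hA2.trans h1
        _ ≤ _ := by gcongr
    have hAC1 := hAC 1 one_pos (by linarith)
    rw [one_mul] at hAC1
    rw [max_eq_right hAC1, add_comm]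
    refine abs_norm_mul_sub_le α ?_
    rw [norm_mul, Complex.norm_real, Real.norm_eq_abs]
    refine le_trans ?_ (hAC δ hδ hkδ)
    exact mul_le_of_le_one_right (norm_nonneg _) (abs_inner_mul_inner_le_one hd hu hv)

/-! ### Small-ball probabilities and perturbation of distribution functions -/

section SmallBall

variable {Ω : Type*} [MeasurableSpace Ω] {μ : Measure Ω} {X : Ω → ℝ} {f : ℝ → ℝ}

theorem measureReal_preimage_Icc_le (hX : AEMeasurable X μ)
    (hlaw : μ.map X = volume.withDensity fun x => ENNReal.ofReal (f x)) {M : ℝ} (hM : 0 ≤ M)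
    (hf : ∀ x, f x ≤ M) {a b : ℝ} (hab : a ≤ b) :
    μ.real (X ⁻¹' Set.Icc a b) ≤ M * (b - a) := by
  refine ENNReal.toReal_le_of_le_ofReal (mul_nonneg hM (sub_nonneg.2 hab)) ?_
  rw [← Measure.map_apply_of_aemeasurable hX measurableSet_Icc, hlaw,
    withDensity_apply _ measurableSet_Icc, ENNReal.ofReal_mul hM, ← Real.volume_Icc,
    ← setLIntegral_const]
  exact lintegral_mono fun x => ENNReal.ofReal_le_ofReal (hf x)

theorem measureReal_abs_le (hX : AEMeasurable X μ)
    (hlaw : μ.map X = volume.withDensity fun x => ENNReal.ofReal (f x)) {M : ℝ} (hM : 0 ≤ M)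
    (hf : ∀ x, f x ≤ M) {x : ℝ} (hx : 0 ≤ x) :
    μ.real {ω | |X ω| ≤ x} ≤ 2 * M * x := by
  have h := measureReal_preimage_Icc_le hX hlaw hM hf (neg_le_self hx)
  have hset : {ω | |X ω| ≤ x} = X ⁻¹' Set.Icc (-x) x := by
    exact Set.ext fun ω => (abs_le : |X ω| ≤ x ↔ _)
  rw [hset]
  linarith

variable [IsProbabilityMeasure μ]

theorem cdfOf_eq_real {Y : Ω → ℝ} (hY : AEMeasurable Y μ) (s : ℝ) :
    cdfOf μ Y s = μ.real {ω | Y ω ≤ s} := by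
  have := Measure.isProbabilityMeasure_map hY
  rw [cdfOf, cdf_eq_real, measureReal_def, Measure.map_apply_of_aemeasurable hY measurableSet_Iic]
  rfl

theorem cdfOf_sq_of_neg {Y : Ω → ℝ} (hY : AEMeasurable (fun ω => Y ω ^ 2) μ) {s : ℝ}
    (hs : s < 0) : cdfOf μ (fun ω => Y ω ^ 2) s = 0 := by
  rw [cdfOf_eq_real hY]
  convert measureReal_empty (μ := μ)
  ext ω
  have := sq_nonneg (Y ω)
  simp only [Set.mem_ofPred_eq, Set.mem_empty_iff_false, iff_false, not_le]
  linarith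

theorem cdfOf_sq_mul_sq (hX : AEMeasurable X μ) {h s : ℝ} (hh : 0 < h) (hs : 0 ≤ s) :
    cdfOf μ (fun ω => h ^ 2 * X ω ^ 2) s = μ.real {ω | |X ω| ≤ √s / h} := by
  rw [cdfOf_eq_real (by fun_prop)]
  congr 1
  ext ω
  simp only [Set.mem_ofPred_eq]
  rw [le_div_iff₀ hh, Real.le_sqrt (by positivity) hs, mul_pow, sq_abs, mul_comm]

theorem le_measureReal_preimage_Icc (hX : AEMeasurable X μ)
    (hlaw : μ.map X = volume.withDensity fun x => ENNReal.ofReal (f x)) {m : ℝ} (hm : 0 ≤ m)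
    {a b : ℝ} (hf : ∀ x ∈ Set.Icc a b, m ≤ f x) :
    m * (b - a) ≤ μ.real (X ⁻¹' Set.Icc a b) := by
  rw [measureReal_def, ← ENNReal.ofReal_le_iff_le_toReal (measure_ne_top _ _),
    ← Measure.map_apply_of_aemeasurable hX measurableSet_Icc, hlaw,
    withDensity_apply _ measurableSet_Icc, ENNReal.ofReal_mul hm, ← Real.volume_Icc,
    ← setLIntegral_const]
  exact setLIntegral_mono' measurableSet_Icc fun x hx => ENNReal.ofReal_le_ofReal (hf x hx)

/-- The extra set is covered by two intervals of length `y - x`. No sign is imposed on `x`, so the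
bound also applies at a negative radius `x - δ`. -/
theorem measureReal_abs_le_add (hX : AEMeasurable X μ)
    (hlaw : μ.map X = volume.withDensity fun x => ENNReal.ofReal (f x)) {M : ℝ} (hM : 0 ≤ M)
    (hf : ∀ x, f x ≤ M) {x y : ℝ} (hxy : x ≤ y) :
    μ.real {ω | |X ω| ≤ y} ≤ μ.real {ω | |X ω| ≤ x} + 2 * M * (y - x) := by
  have h1 := measureReal_preimage_Icc_le hX hlaw hM hf hxy
  have h2 := measureReal_preimage_Icc_le hX hlaw hM hf (neg_le_neg hxy)
  have hsub : {ω | |X ω| ≤ y} ⊆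
      {ω | |X ω| ≤ x} ∪ (X ⁻¹' Set.Icc x y ∪ X ⁻¹' Set.Icc (-y) (-x)) := by
    intro ω hω
    have hω' := abs_le.1 (show |X ω| ≤ y from hω)
    rcases le_or_gt x (X ω) with h | h
    · exact Or.inr (Or.inl ⟨h, hω'.2⟩)
    · rcases le_or_gt (X ω) (-x) with h' | h'
      · exact Or.inr (Or.inr ⟨hω'.1, h'⟩)
      · exact Or.inl (abs_le.2 ⟨h'.le, h.le⟩)
  have h3 := (measureReal_mono (μ := μ) hsub).trans (measureReal_union_le _ _)
  have h4 := measureReal_union_le (μ := μ) (X ⁻¹' Set.Icc x y) (X ⁻¹' Set.Icc (-y) (-x))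
  linarith

/-- The upper bound uses that `f` is maximal at `0`; the lower one uses that continuity keeps `f`
above `(1 - ε) * f 0` near `0`. -/
theorem exists_measureReal_abs_le_div_sub_one_le (hX : AEMeasurable X μ)
    (hlaw : μ.map X = volume.withDensity fun x => ENNReal.ofReal (f x)) (hfc : ContinuousAt f 0)
    (hf0 : 0 < f 0) (hf : ∀ x, f x ≤ f 0) {ε : ℝ} (hε : 0 < ε) :
    ∃ η > 0, ∀ x, 0 < x → x ≤ η → |μ.real {ω | |X ω| ≤ x} / (2 * f 0 * x) - 1| ≤ ε := by
  have hlt : (1 - ε) * f 0 < f 0 := by nlinarith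
  obtain ⟨η, hη, hball⟩ := Metric.eventually_nhds_iff.1 (hfc.eventually (eventually_gt_nhds hlt))
  refine ⟨η / 2, half_pos hη, fun x hx hxη => ?_⟩
  have hup := measureReal_abs_le hX hlaw hf0.le hf hx.le
  have hpos : 0 < 2 * f 0 * x := by positivity
  have hlow : (1 - ε) * (2 * f 0 * x) ≤ μ.real {ω | |X ω| ≤ x} := by
    -- `ε` may exceed `1`; the lower bound is then trivial.
    rcases le_total (1 - ε) 0 with h | h
    · exact (mul_nonpos_of_nonpos_of_nonneg h hpos.le).trans measureReal_nonneg
    · have hset : {ω | |X ω| ≤ x} = X ⁻¹' Set.Icc (-x) x := by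
        exact Set.ext fun ω => (abs_le : |X ω| ≤ x ↔ _)
      have h1 := le_measureReal_preimage_Icc hX hlaw (mul_nonneg h hf0.le) (a := -x) (b := x)
        fun y hy => (hball (by
          rw [Real.dist_eq, sub_zero]
          have := abs_le.2 (Set.mem_Icc.1 hy)
          linarith)).le
      rw [hset]
      linarith
  rw [abs_le]
  constructor
  · have := (le_div_iff₀ hpos).2 hlow
    linarith
  · have := (div_le_one hpos).2 hup
    linarith

/-- If `|Z|` is within `δ h` of `h |X|`, the distribution functions of `Z²` and `h² X²` differ by at
most `2 M δ`, where `M` bounds the density of `X`. -/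
theorem abs_cdfOf_sq_sub_le (hX : AEMeasurable X μ)
    (hlaw : μ.map X = volume.withDensity fun x => ENNReal.ofReal (f x)) {M : ℝ} (hM : 0 ≤ M)
    (hf : ∀ x, f x ≤ M) {Z : Ω → ℝ} (hZ : AEMeasurable Z μ) (hZ0 : ∀ ω, 0 ≤ Z ω) {h δ : ℝ}
    (hh : 0 < h) (hδ : 0 ≤ δ) (hZX : ∀ᵐ ω ∂μ, |Z ω - h * (|X ω|)| ≤ δ * h) (s : ℝ) :
    |cdfOf μ (fun ω => Z ω ^ 2) s - cdfOf μ (fun ω => h ^ 2 * X ω ^ 2) s| ≤ 2 * M * δ := by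
  have hZ2 : AEMeasurable (fun ω => Z ω ^ 2) μ := by fun_prop
  rcases lt_or_ge s 0 with hs | hs
  · have h1 : cdfOf μ (fun ω => h ^ 2 * X ω ^ 2) s = 0 := by
      simp_rw [← mul_pow]
      exact cdfOf_sq_of_neg (by fun_prop) hs
    rw [cdfOf_sq_of_neg hZ2 hs, h1, sub_self, abs_zero]
    positivity
  · rw [cdfOf_sq_mul_sq hX hh hs, cdfOf_eq_real hZ2]
    -- Up to null sets, `{|X| ≤ x - δ} ⊆ {Z² ≤ s} ⊆ {|X| ≤ x + δ}`, and each outer set differs from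
    -- `{|X| ≤ x}` by probability at most `2 * M * δ`.
    set x := √s / h with hx
    have hsx : √s = x * h := by rw [hx]; field_simp
    have hmem : ∀ ω, Z ω ^ 2 ≤ s ↔ Z ω ≤ x * h := fun ω => by
      rw [← hsx, Real.le_sqrt (hZ0 ω) hs]
    have hup : μ.real {ω | Z ω ^ 2 ≤ s} ≤ μ.real {ω | |X ω| ≤ x + δ} := by
      refine ENNReal.toReal_mono (measure_ne_top _ _) (measure_mono_ae ?_)
      filter_upwards [hZX] with ω hω hωs
      have h1 := (hmem ω).1 hωs
      have h2 := (abs_le.1 hω).1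
      exact le_of_mul_le_mul_left (by linarith : h * |X ω| ≤ h * (x + δ)) hh
    have hlow : μ.real {ω | |X ω| ≤ x - δ} ≤ μ.real {ω | Z ω ^ 2 ≤ s} := by
      refine ENNReal.toReal_mono (measure_ne_top _ _) (measure_mono_ae ?_)
      filter_upwards [hZX] with ω hω hωs
      refine (hmem ω).2 ?_
      have h1 := mul_le_mul_of_nonneg_left (show |X ω| ≤ x - δ from hωs) hh.le
      have h2 := (abs_le.1 hω).2
      linarith
    have h1 := measureReal_abs_le_add hX hlaw hM hf (le_add_of_nonneg_right hδ : x ≤ x + δ)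
    have h2 := measureReal_abs_le_add hX hlaw hM hf (sub_le_self x hδ)
    rw [abs_le]
    constructor <;> linarith

end SmallBall

/-! ### Convergence of the exact channel distribution -/

theorem continuous_channel (α : ℂ) (kr : ℝ) (d : E3) :
    Continuous fun p : E3 × E3 => channel α kr d p.1 p.2 := by
  have h1 : Continuous fun p : E3 × E3 => (JNF d p.1 p.2 : ℂ) :=
    Complex.continuous_ofReal.comp (Region.continuous_J .near d)
  have h2 : Continuous fun p : E3 × E3 => (JFF d p.1 p.2 : ℂ) :=
    Complex.continuous_ofReal.comp (Region.continuous_J .far d)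
  exact continuous_const.mul ((continuous_const.mul h1).add (continuous_const.mul h2))

theorem measurable_norm_channel (α : ℂ) (kr : ℝ) (d : E3) :
    Measurable fun p : E3 × E3 => ‖channel α kr d p.1 p.2‖ := by
  have h : Continuous fun p : E3 × E3 => ‖channel α kr d p.1 p.2‖ := (continuous_channel α kr d).norm
  exact h.measurable

theorem Region.eventually_abs_cdfOf_sub_le {Ω : Type*} [MeasurableSpace Ω] {μ : Measure Ω}
    [IsProbabilityMeasure μ] {oTx oRx : Ω → E3} (hTx : HasLaw oTx uniformSphere μ)
    (hRx : HasLaw oRx uniformSphere μ) (hindep : IndepFun oTx oRx μ) {d : E3} (hd : ‖d‖ = 1)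
    (R : Region) {ε : ℝ} (hε : 0 < ε) :
    ∀ᶠ kr in R.regime, ∀ α : ℂ, α ≠ 0 → ∀ s : ℝ,
      |cdfOf μ (fun ω => ‖channel α kr d (oTx ω) (oRx ω)‖ ^ 2) s
        - cdfOf μ (fun ω => hOptAbs α kr d ^ 2 * R.J d (oTx ω) (oRx ω) ^ 2) s| ≤ ε := by
  have hpair := hTx.aemeasurable.prodMk hRx.aemeasurable
  have hJm : AEMeasurable (fun ω => R.J d (oTx ω) (oRx ω)) μ :=
    (R.continuous_J d).measurable.comp_aemeasurable hpair
  have hf0 := R.pdf_zero_pos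
  -- This `δ` makes the perturbation bound `2 * R.pdf 0 * δ` equal to `ε`.
  have hδ : 0 < ε / (2 * R.pdf 0) := by positivity
  have hu : ∀ᵐ ω ∂μ, ‖oTx ω‖ = 1 := by
    refine ae_of_ae_map hTx.aemeasurable (p := fun v => ‖v‖ = 1) ?_
    rw [hTx.map_eq]
    exact ae_norm_eq_one_uniformSphere
  have hv : ∀ᵐ ω ∂μ, ‖oRx ω‖ = 1 := by
    refine ae_of_ae_map hRx.aemeasurable (p := fun v => ‖v‖ = 1) ?_
    rw [hRx.map_eq]
    exact ae_norm_eq_one_uniformSphere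
  refine (R.eventually_abs_norm_channel_sub_le hd hδ).mono fun kr hkr α hα s => ?_
  have hchm := (measurable_norm_channel α kr d).comp_aemeasurable hpair
  have hae : ∀ᵐ ω ∂μ, |‖channel α kr d (oTx ω) (oRx ω)‖ -
      hOptAbs α kr d * (|R.J d (oTx ω) (oRx ω)|)| ≤ ε / (2 * R.pdf 0) * hOptAbs α kr d :=
    (hu.and hv).mono fun ω h => hkr.2 α _ _ h.1 h.2
  have hle := abs_cdfOf_sq_sub_le hJm (R.map_J hTx hRx hindep hd) hf0.le R.pdf_le_zero hchm
    (fun ω => norm_nonneg _) (hOptAbs_pos hα hkr.1 hd) hδ.le hae s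
  have hc : 2 * R.pdf 0 * (ε / (2 * R.pdf 0)) = ε := by field_simp
  exact hle.trans_eq hc

end DipoleChannel

/-! ### Assembly of the four claims -/

theorem proposition2
    {Ω : Type*} [MeasurableSpace Ω] (μ : Measure Ω) [IsProbabilityMeasure μ]
    (oTx oRx : Ω → DipoleChannel.E3)
    (hTx : HasLaw oTx DipoleChannel.uniformSphere μ)
    (hRx : HasLaw oRx DipoleChannel.uniformSphere μ)
    (hindep : IndepFun oTx oRx μ)
    (d : DipoleChannel.E3) (hd : ‖d‖ = 1)
    (R : DipoleChannel.Region) :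
    -- `f_{J_*}` is the continuous probability density of `J_*`
    (Continuous R.pdf ∧
      μ.map (fun ω => R.J d (oTx ω) (oRx ω)) =
        volume.withDensity (fun x => ENNReal.ofReal (R.pdf x))) ∧
    -- upper bound and asymptotic tightness for `|h|² = |h_opt|² J_*²`
    (∀ (α : ℂ) (kr : ℝ), α ≠ 0 → 0 < kr →
      (∀ s : ℝ, 0 ≤ s →
        DipoleChannel.cdfOf μ
            (fun ω => DipoleChannel.hOptAbs α kr d ^ 2 * R.J d (oTx ω) (oRx ω) ^ 2) s
          ≤ 2 * R.pdf 0 / DipoleChannel.hOptAbs α kr d * √s) ∧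
      Tendsto (fun s : ℝ =>
          DipoleChannel.cdfOf μ
              (fun ω => DipoleChannel.hOptAbs α kr d ^ 2 * R.J d (oTx ω) (oRx ω) ^ 2) s
            / (2 * R.pdf 0 / DipoleChannel.hOptAbs α kr d * √s))
        (𝓝[>] 0) (𝓝 1)) ∧
    -- in the regime of the region, the distribution of the exact `|h|²` approaches that of
    -- `|h_opt|² J_*²`, uniformly in `s` and in the prefactor
    (∀ ε : ℝ, 0 < ε → ∀ᶠ kr in R.regime, ∀ α : ℂ, α ≠ 0 → ∀ s : ℝ,
      |DipoleChannel.cdfOf μ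
            (fun ω => ‖DipoleChannel.channel α kr d (oTx ω) (oRx ω)‖ ^ 2) s
          - DipoleChannel.cdfOf μ
            (fun ω => DipoleChannel.hOptAbs α kr d ^ 2 * R.J d (oTx ω) (oRx ω) ^ 2) s| ≤ ε) ∧
    -- the square-root approximation for the exact `|h|²` is accurate for small `s / |h_opt|²`
    (∀ ε : ℝ, 0 < ε → ∃ τ : ℝ, 0 < τ ∧ ∀ t : ℝ, 0 < t → t < τ →
      ∀ᶠ kr in R.regime, ∀ α : ℂ, α ≠ 0 → ∀ s : ℝ,
        t * DipoleChannel.hOptAbs α kr d ^ 2 ≤ s → s ≤ τ * DipoleChannel.hOptAbs α kr d ^ 2 →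
        |DipoleChannel.cdfOf μ
              (fun ω => ‖DipoleChannel.channel α kr d (oTx ω) (oRx ω)‖ ^ 2) s
            / (2 * R.pdf 0 / DipoleChannel.hOptAbs α kr d * √s) - 1| ≤ ε) := by
  have hTxm := hTx.aemeasurable
  have hRxm := hRx.aemeasurable
  have hlaw := DipoleChannel.Region.map_J hTx hRx hindep hd R
  have hJm : AEMeasurable (fun ω => R.J d (oTx ω) (oRx ω)) μ :=
    (R.continuous_J d).measurable.comp_aemeasurable (hTxm.prodMk hRxm)
  have hf0 := R.pdf_zero_pos
  have hclose : ∀ ε : ℝ, 0 < ε → ∀ᶠ kr in R.regime, ∀ α : ℂ, α ≠ 0 → ∀ s : ℝ,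
      |DipoleChannel.cdfOf μ
            (fun ω => ‖DipoleChannel.channel α kr d (oTx ω) (oRx ω)‖ ^ 2) s
          - DipoleChannel.cdfOf μ
            (fun ω => DipoleChannel.hOptAbs α kr d ^ 2 * R.J d (oTx ω) (oRx ω) ^ 2) s| ≤ ε :=
    fun ε hε => R.eventually_abs_cdfOf_sub_le hTx hRx hindep hd hε
  have hpos : ∀ᶠ kr in R.regime, 0 < kr :=
    (R.eventually_abs_norm_channel_sub_le hd one_pos).mono fun kr h => h.1
  refine ⟨⟨R.continuous_pdf, hlaw⟩, fun α kr hα hkr => ?_, hclose, fun ε hε => ?_⟩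
  · have hh := DipoleChannel.hOptAbs_pos hα hkr hd
    set h := DipoleChannel.hOptAbs α kr d
    have hrhs : ∀ s, 2 * R.pdf 0 / h * √s = 2 * R.pdf 0 * (√s / h) := fun s => by ring
    refine ⟨fun s hs => ?_, Metric.tendsto_nhds.2 fun ε hε => ?_⟩
    · rw [DipoleChannel.cdfOf_sq_mul_sq hJm hh hs, hrhs]
      exact DipoleChannel.measureReal_abs_le hJm hlaw hf0.le R.pdf_le_zero (by positivity)
    · obtain ⟨η, hη, hηx⟩ := DipoleChannel.exists_measureReal_abs_le_div_sub_one_le hJm hlaw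
        R.continuous_pdf.continuousAt hf0 R.pdf_le_zero (half_pos hε)
      have hsq : 0 < (η * h) ^ 2 := by positivity
      filter_upwards [Ioo_mem_nhdsGT hsq] with s hs
      have hs0 : 0 < √s := Real.sqrt_pos.2 hs.1
      rw [DipoleChannel.cdfOf_sq_mul_sq hJm hh hs.1.le, hrhs, Real.dist_eq]
      refine (hηx _ (by positivity) ?_).trans_lt (half_lt_self hε)
      rw [div_le_iff₀ hh]
      exact (Real.sqrt_le_left (by positivity)).2 hs.2.le
  · obtain ⟨η, hη, hηx⟩ := DipoleChannel.exists_measureReal_abs_le_div_sub_one_le hJm hlaw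
      R.continuous_pdf.continuousAt hf0 R.pdf_le_zero (half_pos hε)
    -- With `x = √s / h`, the bound `s ≤ η ^ 2 * h ^ 2` says `x ≤ η`, and `t * h ^ 2 ≤ s` says `√t ≤
    -- x`.
    refine ⟨η ^ 2, by positivity, fun t ht _ => ?_⟩
    have ht0 : 0 < √t := Real.sqrt_pos.2 ht
    -- The tolerance is `ε / 2` times the least value `2 * R.pdf 0 * √t` of the denominator on the
    -- window, so after division it costs at most `ε / 2`.
    filter_upwards [hpos, hclose (ε / 2 * (2 * R.pdf 0 * √t)) (by positivity)]
      with kr hkr hcl α hα s hts hsτ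
    have hh := DipoleChannel.hOptAbs_pos hα hkr hd
    have hcl := hcl α hα s
    set h := DipoleChannel.hOptAbs α kr d
    have hs : 0 < s := lt_of_lt_of_le (by positivity) hts
    rw [DipoleChannel.cdfOf_sq_mul_sq hJm hh hs.le] at hcl
    have hrhs : 2 * R.pdf 0 / h * √s = 2 * R.pdf 0 * (√s / h) := by ring
    rw [hrhs]
    have hs0 : 0 < √s := Real.sqrt_pos.2 hs
    have hxη : √s / h ≤ η := by
      rw [div_le_iff₀ hh, Real.sqrt_le_left (by positivity), mul_pow]
      exact hsτ
    have htx : √t ≤ √s / h := by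
      rw [le_div_iff₀ hh, Real.le_sqrt (by positivity) hs.le, mul_pow, Real.sq_sqrt ht.le]
      exact hts
    have hx0 : 0 < √s / h := by positivity
    set x := √s / h
    have h1 := hηx x hx0 hxη
    have hden : 0 < 2 * R.pdf 0 * x := by positivity
    have h2 : |DipoleChannel.cdfOf μ
        (fun ω => ‖DipoleChannel.channel α kr d (oTx ω) (oRx ω)‖ ^ 2) s / (2 * R.pdf 0 * x) -
        μ.real {ω | |R.J d (oTx ω) (oRx ω)| ≤ x} / (2 * R.pdf 0 * x)| ≤ ε / 2 := by
      rw [← sub_div, abs_div, abs_of_pos hden, div_le_iff₀ hden]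
      refine hcl.trans ?_
      gcongr
    calc _ ≤ _ := abs_sub_le _ (μ.real {ω | |R.J d (oTx ω) (oRx ω)| ≤ x} / (2 * R.pdf 0 * x)) 1
      _ ≤ ε := by linarith
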